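/- For $n\ge 0$ let $[n]=\{1,\dots,n\}$. A matroid is \emph{paving} if each of its circuits has cardinality at least the rank of the matroid, and \emph{sparse paving} if both it and its dual are paving. An \emph{automorphism} of a matroid $M$ on $[n]$ is a permutation $\pi$ of $[n]$ such that, for every $X\subseteq[n]$, $X$ is a basis of $M$ if and only if $\pi(X)$ is a basis of $M$. Let $s(n)$ be the number of (labelled) sparse paving matroids with ground set $[n]$, and let $s(n;\Sigma_2)$ be the number of those that have at least one transposition (a permutation of $[n]$ moving exactly two elements) as an automorphism. Then $$\lim_{n\to\infty}\frac{s(n;\Sigma_2)}{s(n)}=0 .$$ -/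

import Mathlib

open Filter Topology

namespace SparsePaving

/-- A matroid is paving if each of its circuits has at least as many elements as the rank. -/
def IsPaving {α : Type*} (M : Matroid α) : Prop :=
  ∀ C : Set α, M.IsCircuit C → M.eRank ≤ C.encard

/-- A matroid is sparse paving if both it and its dual are paving. -/
def IsSparsePaving {α : Type*} (M : Matroid α) : Prop :=
  IsPaving M ∧ IsPaving M.dual

/-- The permutation `π` is an automorphism of `M` (a matroid whose ground set is all of `α`):
a set is a basis if and only if its image under `π` is a basis. -/
def IsAutomorphism {α : Type*} (M : Matroid α) (π : Equiv.Perm α) : Prop :=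
  ∀ X : Set α, M.IsBase X ↔ M.IsBase (π '' X)

/-- The sparse paving matroids on a fixed labelled ground set of `n` elements. -/
def sparsePavingMatroids (n : ℕ) : Set (Matroid (Fin n)) :=
  {M | M.E = Set.univ ∧ IsSparsePaving M}

/-- The sparse paving matroids on `n` labelled elements that have some member of `S` as an
automorphism. -/
def sparsePavingMatroidsWithAut (n : ℕ) (S : Set (Equiv.Perm (Fin n))) :
    Set (Matroid (Fin n)) :=
  {M ∈ sparsePavingMatroids n | ∃ π ∈ S, IsAutomorphism M π}

/-- The transpositions of `n` elements: the permutations that move exactly two elements. -/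
def transpositions (n : ℕ) : Set (Equiv.Perm (Fin n)) :=
  {π | π.support.card = 2}

/-- There are finitely many matroids on a finite type, so `Set.ncard` is a true cardinality on
the sets of matroids considered here. -/
theorem finite_matroid (α : Type*) [Finite α] : Finite (Matroid α) :=
  Finite.of_injective (fun M : Matroid α => (M.E, {B | M.IsBase B})) (by
    intro M N h
    obtain ⟨h1, h2⟩ := Prod.mk.inj h
    exact Matroid.ext_isBase h1 (fun B _ => Set.ext_iff.1 h2 B))

/-- The number of sparse paving matroids on `n` labelled elements is positive. -/
theorem sparsePavingMatroids_ncard_pos (n : ℕ) : 0 < (sparsePavingMatroids n).ncard := by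
  have := finite_matroid (Fin n)
  refine (Set.ncard_pos (Set.toFinite _)).2 ⟨Matroid.freeOn Set.univ, rfl, ?_, ?_⟩
  · intro C hC
    exact absurd (by simp) hC.not_indep
  · intro C _
    simp

end SparsePaving

/-! For `0 < r < n`, the nonbases of a sparse paving matroid of rank `r` form a stable set of the
Johnson graph on `r`-sets, and every stable set arises this way. If the transposition of `a` and `b`
is an automorphism, no nonbasis separates `a` from `b`: it would be adjacent to its own image.

Such symmetric families are rare by a local switching. Given a symmetric `S` and an `(r-1)`-set `Y`
avoiding `a, b`, force `X = Y + a` into `S` by deleting its neighbours. A neighbour not separating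
`a, b` has the form `Y + c` or `Y + a + b - c`, and stability allows at most one of each. Since `X`
is the only member of the new family separating `a, b`, the family together with two optional labels
determines `(S, Y)`. Thus symmetric families number at most `(n+1)^2 / C(n-2, r-1)` times all stable
families (`card_stableFamiliesWithPair_mul_choose_le`).

If `C(n-2, r-1) > n^5`, this ratio beats the union bound over fewer than `n^2` pairs. The remaining
ranks contribute at most `2^(n^6)` families per pair, which is negligible because the Graham–Sloane
construction yields at least `2^(n^7)` sparse paving matroids for large `n`. -/

namespace SparsePaving

/-- A family of `r`-element sets, no two of which differ by exchanging a single element. -/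
def IsStableFamily {α : Type*} [DecidableEq α] (r : ℕ) (S : Finset (Finset α)) : Prop :=
  (∀ X ∈ S, X.card = r) ∧ ∀ X ∈ S, ∀ Y ∈ S, X ≠ Y → (X ∩ Y).card + 2 ≤ r

/-! ### Stable sets of the Johnson graph -/

section Stable

variable {α : Type*} [DecidableEq α] {r : ℕ} {S : Finset (Finset α)}

theorem IsStableFamily.card_eq (h : IsStableFamily r S) {X : Finset α} (hX : X ∈ S) :
    X.card = r := h.1 X hX

theorem IsStableFamily.eq_of_mem (h : IsStableFamily r S) {X Y : Finset α} (hX : X ∈ S)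
    (hY : Y ∈ S) (hXY : r ≤ (X ∩ Y).card + 1) : X = Y := by
  by_contra hne
  have := h.2 X hX Y hY hne
  omega

theorem IsStableFamily.mono (h : IsStableFamily r S) {T : Finset (Finset α)} (hT : T ⊆ S) :
    IsStableFamily r T :=
  ⟨fun X hX => h.1 X (hT hX), fun X hX Y hY => h.2 X (hT hX) Y (hT hY)⟩

/-- Two one-element extensions of the same set of size at least `r - 1` that belong to a stable
family agree. -/
theorem IsStableFamily.eq_of_insert_mem (h : IsStableFamily r S) {Y : Finset α} {c d : α}
    (hY : Y.card + 1 = r) (hc : insert c Y ∈ S) (hd : insert d Y ∈ S) : c = d := by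
  have hcY : c ∉ Y := fun hcY => by
    have := h.card_eq hc
    rw [Finset.insert_eq_of_mem hcY] at this
    omega
  have heq : insert c Y = insert d Y := h.eq_of_mem hc hd (by
    have : Y ⊆ insert c Y ∩ insert d Y :=
      Finset.subset_inter (Finset.subset_insert _ _) (Finset.subset_insert _ _)
    have := Finset.card_le_card this
    omega)
  have : c ∈ insert d Y := heq ▸ Finset.mem_insert_self c Y
  simpa [hcY] using this

/-- Two one-element deletions of the same set of size `r + 1` that belong to a stable family
agree. -/
theorem IsStableFamily.eq_of_erase_mem (h : IsStableFamily r S) {W : Finset α} {c d : α}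
    (hW : W.card = r + 1) (hc : W.erase c ∈ S) (hd : W.erase d ∈ S) : c = d := by
  have key : ∀ e, W.erase e ∈ S → e ∈ W := fun e he => by
    by_contra hcW
    have := h.card_eq he
    rw [Finset.erase_eq_of_notMem hcW] at this
    omega
  have heq : W.erase c = W.erase d := h.eq_of_mem hc hd (by
    have h1 : (W.erase c).erase d ⊆ W.erase c ∩ W.erase d :=
      Finset.subset_inter (Finset.erase_subset _ _)
        (Finset.erase_subset_erase _ (Finset.erase_subset _ _))
    have h2 := Finset.card_le_card h1
    have h3 := Finset.pred_card_le_card_erase (s := W.erase c) (a := d)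
    have h4 := h.card_eq hc
    omega)
  by_contra hne
  have : c ∈ W.erase d := Finset.mem_erase.2 ⟨hne, key c hc⟩
  rw [← heq] at this
  simp at this

/-- Enlarge `Z` to size `r - 1`. As `r < n`, at least two elements remain, and the two extensions
cannot both lie in `S`. This makes every set smaller than `r` independent; the next lemma is the
dual version. -/
theorem IsStableFamily.exists_superset_notMem [Fintype α] (h : IsStableFamily r S)
    (hr : r < Fintype.card α) {Z : Finset α} (hZ : Z.card < r) :
    ∃ X, Z ⊆ X ∧ X.card = r ∧ X ∉ S := by
  obtain ⟨Y, hZY, -, hY⟩ := Finset.exists_subsuperset_card_eq (Finset.subset_univ Z)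
    (n := r - 1) (by omega) (by rw [Finset.card_univ]; omega)
  have hc : 1 < Yᶜ.card := by rw [Finset.card_compl]; omega
  obtain ⟨c, hc, d, hd, hcd⟩ := Finset.one_lt_card.1 hc
  rw [Finset.mem_compl] at hc hd
  by_cases hcS : insert c Y ∈ S
  · refine ⟨insert d Y, hZY.trans (Finset.subset_insert _ _), ?_, fun hdS => hcd ?_⟩
    · rw [Finset.card_insert_of_notMem hd]; omega
    · exact h.eq_of_insert_mem (by omega) hcS hdS
  · refine ⟨insert c Y, hZY.trans (Finset.subset_insert _ _), ?_, hcS⟩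
    rw [Finset.card_insert_of_notMem hc]; omega

theorem IsStableFamily.exists_subset_notMem (h : IsStableFamily r S)
    (hr : 0 < r) {Z : Finset α} (hZ : r < Z.card) :
    ∃ X, X ⊆ Z ∧ X.card = r ∧ X ∉ S := by
  obtain ⟨W, hWZ, hW⟩ := Finset.exists_subset_card_eq (s := Z) (n := r + 1) (by omega)
  obtain ⟨c, hc, d, hd, hcd⟩ := Finset.one_lt_card.1 (show 1 < W.card by omega)
  by_cases hcS : W.erase c ∈ S
  · refine ⟨W.erase d, (Finset.erase_subset _ _).trans hWZ, ?_, fun hdS => hcd ?_⟩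
    · rw [Finset.card_erase_of_mem hd]; omega
    · exact h.eq_of_erase_mem hW hcS hdS
  · refine ⟨W.erase c, (Finset.erase_subset _ _).trans hWZ, ?_, hcS⟩
    rw [Finset.card_erase_of_mem hc]; omega

/-- Remove from `S` the members adjacent to `X`, then add `X`. -/
def exchangeIn (r : ℕ) (S : Finset (Finset α)) (X : Finset α) : Finset (Finset α) :=
  insert X (S.filter fun Z => (Z ∩ X).card + 2 ≤ r)

theorem IsStableFamily.exchangeIn (h : IsStableFamily r S) {X : Finset α} (hX : X.card = r) :
    IsStableFamily r (exchangeIn r S X) := by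
  simp only [IsStableFamily, SparsePaving.exchangeIn, Finset.mem_insert, Finset.mem_filter]
  constructor
  · rintro Z (rfl | ⟨hZ, -⟩)
    exacts [hX, h.card_eq hZ]
  · rintro Z (rfl | ⟨hZ, hZX⟩) W (rfl | ⟨hW, hWX⟩) hne
    · exact absurd rfl hne
    · rwa [Finset.inter_comm]
    · exact hZX
    · exact h.2 Z hZ W hW hne

theorem eq_insert_of_subset_card {Y Z : Finset α} (hYZ : Y ⊆ Z) (h : Z.card = Y.card + 1) :
    ∃ c, Z = insert c Y := by
  obtain ⟨c, hc⟩ := Finset.card_eq_one.1 (show (Z \ Y).card = 1 by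
    rw [Finset.card_sdiff_of_subset hYZ]; omega)
  refine ⟨c, ?_⟩
  rw [← Finset.sdiff_union_of_subset hYZ, hc, Finset.insert_eq]

theorem eq_erase_of_subset_card {W Z : Finset α} (hZW : Z ⊆ W) (h : W.card = Z.card + 1) :
    ∃ c, Z = W.erase c := by
  obtain ⟨c, hc⟩ := Finset.card_eq_one.1 (show (W \ Z).card = 1 by
    rw [Finset.card_sdiff_of_subset hZW]; omega)
  refine ⟨c, ?_⟩
  rw [Finset.erase_eq, ← hc, Finset.sdiff_sdiff_eq_self hZW]

/-- A set adjacent to `insert a Y` that contains both or neither of `a` and `b` is a one-element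
extension of `Y` or a one-element deletion of `insert b (insert a Y)`. -/
theorem eq_insert_or_eq_erase {Y Z : Finset α} {a b : α} (hab : a ≠ b) (ha : a ∉ Y) (hb : b ∉ Y)
    (hZ : Z.card = Y.card + 1) (hiff : a ∈ Z ↔ b ∈ Z)
    (hZX : Y.card ≤ (Z ∩ insert a Y).card) :
    (∃ c, Z = insert c Y) ∨ ∃ c, Z = (insert b (insert a Y)).erase c := by
  by_cases haZ : a ∈ Z
  · right
    have hbX : b ∉ insert a Y := by simp [hab.symm, hb]
    apply eq_erase_of_subset_card
    · have h1 : (Z \ insert a Y).card ≤ 1 := by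
        have := Finset.card_sdiff_add_card_inter Z (insert a Y)
        omega
      intro z hz
      by_cases hzX : z ∈ insert a Y
      · exact Finset.mem_insert_of_mem hzX
      · rw [Finset.card_le_one.1 h1 z (Finset.mem_sdiff.2 ⟨hz, hzX⟩) b
          (Finset.mem_sdiff.2 ⟨hiff.1 haZ, hbX⟩)]
        exact Finset.mem_insert_self _ _
    · rw [Finset.card_insert_of_notMem hbX, Finset.card_insert_of_notMem ha]; omega
  · left
    apply eq_insert_of_subset_card _ hZ
    rw [Finset.inter_insert_of_notMem haZ] at hZX
    exact Finset.inter_eq_right.1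
      (Finset.eq_of_subset_of_card_le Finset.inter_subset_right hZX)

end Stable

/-! ### Switching bound for families that do not separate a pair -/

open Classical in
/-- All stable families of `r`-element subsets of an `n`-element set. -/
noncomputable def stableFamilies (n r : ℕ) : Finset (Finset (Finset (Fin n))) :=
  Finset.univ.filter (IsStableFamily r)

open Classical in
/-- The stable families each of whose members contains both or neither of `a` and `b`. -/
noncomputable def stableFamiliesWithPair {n : ℕ} (r : ℕ) (a b : Fin n) :
    Finset (Finset (Finset (Fin n))) :=
  (stableFamilies n r).filter fun S => ∀ Z ∈ S, a ∈ Z ↔ b ∈ Z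

theorem mem_stableFamilies {n r : ℕ} {S : Finset (Finset (Fin n))} :
    S ∈ stableFamilies n r ↔ IsStableFamily r S := by
  simp [stableFamilies]

theorem mem_stableFamiliesWithPair {n r : ℕ} {a b : Fin n} {S : Finset (Finset (Fin n))} :
    S ∈ stableFamiliesWithPair r a b ↔ IsStableFamily r S ∧ ∀ Z ∈ S, a ∈ Z ↔ b ∈ Z := by
  simp [stableFamiliesWithPair, mem_stableFamilies]

theorem card_filter_card_le_one (n : ℕ) :
    (Finset.univ.filter fun d : Finset (Fin n) => d.card ≤ 1).card ≤ n + 1 := by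
  have h : (Finset.univ.filter fun d : Finset (Fin n) => d.card ≤ 1) ⊆
      Finset.univ.image (Option.toFinset : Option (Fin n) → Finset (Fin n)) := by
    intro d hd
    simp only [Finset.mem_filter, Finset.mem_univ, true_and] at hd
    simp only [Finset.mem_image, Finset.mem_univ, true_and]
    rcases d.eq_empty_or_nonempty with rfl | ⟨c, hc⟩
    · exact ⟨none, rfl⟩
    · refine ⟨some c, ?_⟩
      rw [Option.toFinset_some]
      exact (Finset.eq_singleton_iff_unique_mem.2
        ⟨hc, fun x hx => Finset.card_le_one.1 hd x hx c hc⟩).symm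
  refine (Finset.card_le_card h).trans (Finset.card_image_le.trans ?_)
  simp

theorem card_stableFamiliesWithPair_mul_choose_le {n r : ℕ} {a b : Fin n} (hab : a ≠ b)
    (hr : 0 < r) :
    (stableFamiliesWithPair r a b).card * (n - 2).choose (r - 1) ≤
      (n + 1) ^ 2 * (stableFamilies n r).card := by
  classical
  set D := Finset.univ.filter fun d : Finset (Fin n) => d.card ≤ 1 with hD
  set E := Finset.powersetCard (r - 1) ((Finset.univ.erase a).erase b) with hE
  have hEcard : E.card = (n - 2).choose (r - 1) := by
    rw [hE, Finset.card_powersetCard, Finset.card_erase_of_mem (by simp [hab.symm]),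
      Finset.card_erase_of_mem (by simp)]
    simp [Nat.sub_sub]
  have hmemE : ∀ Y ∈ E, a ∉ Y ∧ b ∉ Y ∧ Y.card + 1 = r := by
    intro Y hY
    rw [hE, Finset.mem_powersetCard] at hY
    refine ⟨fun h => by simpa using hY.1 h, fun h => by simpa using hY.1 h, by omega⟩
  -- The two recorded sets have at most one element each; they hold the labels of the members of `S`
  -- that the exchange may delete.
  let f : Finset (Finset (Fin n)) × Finset (Fin n) →
      (Finset (Fin n) × Finset (Fin n)) × Finset (Finset (Fin n)) := fun p =>
    ((Finset.univ.filter fun c => insert c p.2 ∈ p.1,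
      Finset.univ.filter fun c => (insert b (insert a p.2)).erase c ∈ p.1),
      exchangeIn r p.1 (insert a p.2))
  have hmaps : ∀ p ∈ stableFamiliesWithPair r a b ×ˢ E, f p ∈ (D ×ˢ D) ×ˢ stableFamilies n r := by
    rintro ⟨S, Y⟩ hp
    obtain ⟨hS, hY⟩ := Finset.mem_product.1 hp
    obtain ⟨hS, hpair⟩ := mem_stableFamiliesWithPair.1 hS
    obtain ⟨haY, hbY, hYc⟩ := hmemE Y hY
    simp only [f, Finset.mem_product, hD, Finset.mem_filter, Finset.mem_univ, true_and,
      mem_stableFamilies, Finset.card_le_one]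
    refine ⟨⟨fun c hc d hd => hS.eq_of_insert_mem hYc hc hd,
      fun c hc d hd => hS.eq_of_erase_mem ?_ hc hd⟩, hS.exchangeIn ?_⟩
    · rw [Finset.card_insert_of_notMem (by simp [hab.symm, hbY]),
        Finset.card_insert_of_notMem haY, hYc]
    · rw [Finset.card_insert_of_notMem haY, hYc]
  have hsub : ∀ S Y S' Y', (S, Y) ∈ stableFamiliesWithPair r a b ×ˢ E →
      (S', Y') ∈ stableFamiliesWithPair r a b ×ˢ E → f (S, Y) = f (S', Y') →
      Y = Y' ∧ S ⊆ S' := by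
    intro S Y S' Y' hp hp' hf
    obtain ⟨hS, hY⟩ := Finset.mem_product.1 hp
    obtain ⟨hS, hpair⟩ := mem_stableFamiliesWithPair.1 hS
    obtain ⟨haY, hbY, hYc⟩ := hmemE Y hY
    obtain ⟨hS', hY'⟩ := Finset.mem_product.1 hp'
    obtain ⟨hS', hpair'⟩ := mem_stableFamiliesWithPair.1 hS'
    obtain ⟨haY', hbY', hYc'⟩ := hmemE Y' hY'
    simp only [f, Prod.mk.injEq] at hf
    obtain ⟨⟨h1, h2⟩, h3⟩ := hf
    -- Every other member of the new family contains both or neither of `a, b`, so the inserted set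
    -- is recognisable.
    have hXX : insert a Y = insert a Y' := by
      have hX : insert a Y ∈ exchangeIn r S' (insert a Y') := by
        rw [← h3]; exact Finset.mem_insert_self _ _
      rcases Finset.mem_insert.1 hX with h | h
      · exact h
      · have := (hpair' _ (Finset.mem_filter.1 h).1).1 (Finset.mem_insert_self _ _)
        simp [hab.symm, hbY] at this
    have hYY : Y = Y' := by
      rw [← Finset.erase_insert haY, hXX, Finset.erase_insert haY']
    subst hYY
    refine ⟨rfl, fun Z hZ => ?_⟩
    -- Members not adjacent to the inserted set survive the exchange; the deleted ones are recovered
    -- from the labels.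
    by_cases hZX : (Z ∩ insert a Y).card + 2 ≤ r
    · have : Z ∈ exchangeIn r S' (insert a Y) := by
        rw [← h3]
        exact Finset.mem_insert_of_mem (Finset.mem_filter.2 ⟨hZ, hZX⟩)
      rcases Finset.mem_insert.1 this with rfl | h
      · have := (hpair _ hZ).1 (Finset.mem_insert_self _ _)
        simp [hab.symm, hbY] at this
      · exact (Finset.mem_filter.1 h).1
    · rcases eq_insert_or_eq_erase hab haY hbY (by rw [hS.card_eq hZ, hYc]) (hpair Z hZ)
        (by omega) with ⟨c, rfl⟩ | ⟨c, rfl⟩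
      · have := Finset.ext_iff.1 h1 c
        simp only [Finset.mem_filter, Finset.mem_univ, true_and] at this
        exact this.1 hZ
      · have := Finset.ext_iff.1 h2 c
        simp only [Finset.mem_filter, Finset.mem_univ, true_and] at this
        exact this.1 hZ
  have hinj : Set.InjOn f (stableFamiliesWithPair r a b ×ˢ E : Finset _) := by
    rintro ⟨S, Y⟩ hp ⟨S', Y'⟩ hp' hf
    rw [Finset.mem_coe] at hp hp'
    obtain ⟨rfl, hSS⟩ := hsub S Y S' Y' hp hp' hf
    obtain ⟨-, hSS'⟩ := hsub S' Y S Y hp' hp hf.symm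
    rw [hSS.antisymm hSS']
  have hcard := Finset.card_le_card_of_injOn f hmaps hinj
  rw [Finset.card_product, Finset.card_product, Finset.card_product, hEcard] at hcard
  refine hcard.trans (Nat.mul_le_mul_right _ ?_)
  rw [sq]
  exact Nat.mul_le_mul (card_filter_card_le_one n) (card_filter_card_le_one n)

/-! ### Bounds on the number of stable families -/

theorem card_stableFamilies_le (n r : ℕ) : (stableFamilies n r).card ≤ 2 ^ n.choose r := by
  have h : stableFamilies n r ⊆ (Finset.powersetCard r Finset.univ).powerset := fun S hS =>
    Finset.mem_powerset.2 fun X hX =>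
      Finset.mem_powersetCard.2 ⟨Finset.subset_univ _, (mem_stableFamilies.1 hS).card_eq hX⟩
  simpa using Finset.card_le_card h

/-- The subsets of a stable family are stable families. -/
theorem two_pow_card_le_card_stableFamilies {n r : ℕ} {S : Finset (Finset (Fin n))}
    (hS : IsStableFamily r S) : 2 ^ S.card ≤ (stableFamilies n r).card := by
  rw [← Finset.card_powerset]
  exact Finset.card_le_card fun T hT =>
    mem_stableFamilies.2 (hS.mono (Finset.mem_powerset.1 hT))

/-- The `r`-element sets with prescribed sum modulo `n` form a stable family. -/
theorem isStableFamily_sum_mod (n r k : ℕ) :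
    IsStableFamily r ((Finset.powersetCard r (Finset.univ : Finset (Fin n))).filter
      fun X : Finset (Fin n) => (∑ x ∈ X, (x : ℕ)) % n = k) := by
  simp only [IsStableFamily, Finset.mem_filter, Finset.mem_powersetCard]
  refine ⟨fun X hX => hX.1.2, fun X hX Y hY hne => ?_⟩
  by_contra hcon
  have hlt : (X ∩ Y).card < r := by
    refine lt_of_le_of_ne (hX.1.2 ▸ Finset.card_le_card Finset.inter_subset_left) fun h => hne ?_
    have h1 : X ∩ Y = X :=
      Finset.eq_of_subset_of_card_le Finset.inter_subset_left (by rw [hX.1.2, h])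
    exact Finset.eq_of_subset_of_card_le (Finset.inter_eq_left.1 h1) (by rw [hX.1.2, hY.1.2])
  -- Adjacent members are `W + x` and `W + y` with `W` their intersection. Congruent sums give `x ≡
  -- y` modulo `n`, hence `x = y` as both are below `n`.
  obtain ⟨x, hx⟩ := eq_insert_of_subset_card (Y := X ∩ Y) (Z := X) Finset.inter_subset_left
    (by rw [hX.1.2]; omega)
  obtain ⟨y, hy⟩ := eq_insert_of_subset_card (Y := X ∩ Y) (Z := Y) Finset.inter_subset_right
    (by rw [hY.1.2]; omega)
  generalize X ∩ Y = W at *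
  have hxW : x ∉ W := fun h => by
    rw [Finset.insert_eq_of_mem h] at hx
    rw [← hx, hX.1.2] at hlt
    omega
  have hyW : y ∉ W := fun h => by
    rw [Finset.insert_eq_of_mem h] at hy
    rw [← hy, hY.1.2] at hlt
    omega
  have hmod : (x : ℕ) + ∑ z ∈ W, (z : ℕ) ≡ (y : ℕ) + ∑ z ∈ W, (z : ℕ) [MOD n] := by
    rw [← Finset.sum_insert hxW, ← Finset.sum_insert hyW, ← hx, ← hy]
    exact hX.2.trans hY.2.symm
  have hxy : x = y := Fin.ext ((Nat.ModEq.add_right_cancel' _ hmod).eq_of_lt_of_lt x.2 y.2)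
  exact hne (by rw [hx, hy, hxy])

/-- Graham–Sloane: the middle layer has at least `2^n / (n+1)` sets, so by pigeonhole one of the `n`
residue classes of the sum has at least `k`; all its subfamilies are stable. -/
theorem two_pow_le_card_stableFamilies {n k : ℕ} (hn : 0 < n) (h : n * (n + 1) * k ≤ 2 ^ n) :
    2 ^ k ≤ (stableFamilies n (n / 2)).card := by
  have hmid : 2 ^ n ≤ (n + 1) * n.choose (n / 2) := by
    rw [← Nat.sum_range_choose]
    refine (Finset.sum_le_card_nsmul _ _ _ fun i _ => Nat.choose_le_middle i n).trans ?_
    simp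
  have hk : n * k ≤ n.choose (n / 2) := by
    refine le_of_mul_le_mul_left (a := n + 1) ?_ (by omega)
    calc (n + 1) * (n * k) = n * (n + 1) * k := by ring
      _ ≤ _ := h.trans hmid
  obtain ⟨c, -, hc⟩ := Finset.exists_le_card_fiber_of_mul_le_card_of_maps_to
    (s := Finset.powersetCard (n / 2) (Finset.univ : Finset (Fin n))) (t := Finset.range n)
    (f := fun X : Finset (Fin n) => (∑ x ∈ X, (x : ℕ)) % n) (n := k)
    (fun X _ => Finset.mem_range.2 (Nat.mod_lt _ hn)) ⟨0, Finset.mem_range.2 hn⟩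
    (by simpa using hk)
  exact (Nat.pow_le_pow_right (by norm_num) hc).trans
    (two_pow_card_le_card_stableFamilies (isStableFamily_sum_mod n (n / 2) c))

/-- The ratio of the two binomials is `n(n-1) / (r(n-r))`, and `r(n-r) ≥ n-1`. -/
theorem choose_le_mul_choose_sub_two {n r : ℕ} (hr : 0 < r) (hrn : r < n) :
    n.choose r ≤ n * (n - 2).choose (r - 1) := by
  obtain ⟨s, rfl⟩ : ∃ s, r = s + 1 := ⟨r - 1, by omega⟩
  obtain ⟨t, rfl⟩ : ∃ t, n = s + t + 2 := ⟨n - s - 2, by omega⟩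
  have h1 := Nat.add_one_mul_choose_eq (s + t + 1) s
  have h2 := Nat.choose_mul_succ_eq (s + t) s
  simp only [show s + t + 2 - 2 = s + t by omega, Nat.add_sub_cancel]
  rw [show s + t + 1 - s = t + 1 by omega] at h2
  refine le_of_mul_le_mul_left (a := (s + 1) * (t + 1)) ?_ (by positivity)
  calc (s + 1) * (t + 1) * (s + t + 2).choose (s + 1)
      = (t + 1) * ((s + t + 1 + 1) * (s + t + 1).choose s) := by rw [h1]; ring
    _ = (s + t + 2) * ((s + t).choose s * (s + t + 1)) := by rw [h2]; ring
    _ ≤ (s + t + 2) * ((s + t).choose s * ((s + 1) * (t + 1))) := by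
        gcongr; nlinarith [Nat.zero_le (s * t)]
    _ = _ := by ring

/-! ### From stable families to sparse paving matroids -/

theorem isPaving_of_small_indep {α : Type*} [Finite α] (M : Matroid α)
    (hM : ∀ X : Finset α, (X.card : ℕ∞) < M.eRank → M.Indep X) : IsPaving M := by
  intro C hC
  by_contra! hlt
  obtain ⟨X, rfl⟩ := C.toFinite.exists_finset_coe
  rw [Set.encard_coe_eq_coe_finsetCard] at hlt
  exact hC.not_indep (hM X hlt)

section OfStable

variable {α : Type*} [Fintype α] [DecidableEq α] {r : ℕ} {S : Finset (Finset α)}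

/-- The matroid whose bases are the `r`-element sets outside a stable family. -/
def matroidOfStable (h : IsStableFamily r S) (hr : 0 < r) (hrn : r < Fintype.card α) :
    Matroid α :=
  Matroid.ofIsBaseOfFinite (E := Set.univ) Set.finite_univ
    (fun B => ∃ X : Finset α, (X : Set α) = B ∧ X.card = r ∧ X ∉ S)
    (by
      obtain ⟨X, -, hX⟩ := h.exists_superset_notMem hrn (Z := ∅) (by simpa using hr)
      exact ⟨X, X, rfl, hX⟩)
    (by
      rintro _ _ ⟨X, rfl, hX, hXS⟩ ⟨Y, rfl, hY, hYS⟩ a ⟨haX, haY⟩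
      rw [Finset.mem_coe] at haX haY
      have hZ : (X.erase a).card + 1 = r := by rw [Finset.card_erase_of_mem haX]; omega
      have hb : ∃ b ∈ Y \ X, insert b (X.erase a) ∉ S := by
        -- If every exchange landed in `S`, stability would leave only one element in `Y \ X`; the
        -- exchange would then produce `Y` itself, which is not in `S`.
        by_contra! hcon
        have hone : (Y \ X).card ≤ 1 := Finset.card_le_one.2 fun b hb c hc =>
          h.eq_of_insert_mem hZ (hcon b hb) (hcon c hc)
        have hXY : (X \ Y).card = (Y \ X).card := Finset.card_sdiff_comm (by omega)
        have hpos : 0 < (X \ Y).card := Finset.card_pos.2 ⟨a, by simp [haX, haY]⟩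
        obtain ⟨b, hb⟩ := Finset.card_pos.1 (hXY ▸ hpos)
        have hbXY := Finset.mem_sdiff.1 hb
        have hsub : X.erase a ⊆ Y := fun x hx => by
          obtain ⟨hxa, hx⟩ := Finset.mem_erase.1 hx
          by_contra hxY
          exact hxa (Finset.card_le_one.1 (hXY ▸ hone) x (by simp [hx, hxY]) a
            (by simp [haX, haY]))
        have : insert b (X.erase a) = Y := by
          refine Finset.eq_of_subset_of_card_le (Finset.insert_subset hbXY.1 hsub) ?_
          rw [Finset.card_insert_of_notMem (fun h => hbXY.2 (Finset.mem_of_mem_erase h))]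
          omega
        exact hYS (this ▸ hcon b hb)
      obtain ⟨b, hb, hbS⟩ := hb
      have hbXY := Finset.mem_sdiff.1 hb
      refine ⟨b, by simpa using hbXY, insert b (X.erase a), by simp, ?_, hbS⟩
      rw [Finset.card_insert_of_notMem (fun h => hbXY.2 (Finset.mem_of_mem_erase h)), hZ])
    (fun _ _ => Set.subset_univ _)

variable (h : IsStableFamily r S) (hr : 0 < r) (hrn : r < Fintype.card α)

@[simp]
theorem matroidOfStable_ground : (matroidOfStable h hr hrn).E = Set.univ := rfl

theorem matroidOfStable_isBase {B : Set α} : (matroidOfStable h hr hrn).IsBase B ↔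
    ∃ X : Finset α, (X : Set α) = B ∧ X.card = r ∧ X ∉ S :=
  Iff.rfl

theorem matroidOfStable_isBase_coe {X : Finset α} : (matroidOfStable h hr hrn).IsBase X ↔
    X.card = r ∧ X ∉ S := by
  simp [matroidOfStable_isBase]

theorem matroidOfStable_isSparsePaving : IsSparsePaving (matroidOfStable h hr hrn) := by
  obtain ⟨B, -, hB⟩ := h.exists_superset_notMem hrn (Z := ∅) (by simpa using hr)
  have hBase := (matroidOfStable_isBase_coe h hr hrn).2 hB
  constructor
  · refine isPaving_of_small_indep _ fun X hX => ?_
    rw [← hBase.encard_eq_eRank, Set.encard_coe_eq_coe_finsetCard, Nat.cast_lt, hB.1] at hX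
    obtain ⟨Y, hXY, hY⟩ := h.exists_superset_notMem hrn hX
    exact ((matroidOfStable_isBase_coe h hr hrn).2 hY).indep.subset (by exact_mod_cast hXY)
  · refine isPaving_of_small_indep _ fun X hX => ?_
    change _ < (matroidOfStable h hr hrn)✶.eRank at hX
    rw [← hBase.encard_compl_eq, matroidOfStable_ground, ← Set.compl_eq_univ_sdiff,
      ← Finset.coe_compl, Set.encard_coe_eq_coe_finsetCard, Nat.cast_lt, Finset.card_compl,
      hB.1] at hX
    obtain ⟨Y, hYX, hY⟩ := h.exists_subset_notMem hr (Z := Xᶜ) (by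
      rw [Finset.card_compl]; omega)
    refine ((matroidOfStable_isBase_coe h hr hrn).2 hY).compl_isBase_dual.indep.subset ?_
    intro x hx
    refine ⟨Set.mem_univ x, fun hxY => ?_⟩
    exact Finset.mem_compl.1 (hYX (Finset.mem_coe.1 hxY)) (Finset.mem_coe.1 hx)

end OfStable

/-! ### From sparse paving matroids to stable families -/

section Nonbases

variable {α : Type*} [Fintype α]

open Classical in
/-- The `r`-element sets that are not bases of `M`. -/
noncomputable def nonbases (r : ℕ) (M : Matroid α) : Finset (Finset α) :=
  Finset.univ.filter fun X => X.card = r ∧ ¬ M.IsBase X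

theorem mem_nonbases {r : ℕ} {M : Matroid α} {X : Finset α} :
    X ∈ nonbases r M ↔ X.card = r ∧ ¬ M.IsBase X := by
  simp [nonbases]

/-- A nonbasis of size `r` is dependent, and paving forces any circuit inside it to have size at
least `r`. -/
theorem isCircuit_of_mem_nonbases {r : ℕ} {M : Matroid α} (hE : M.E = Set.univ)
    (hM : IsPaving M) (hr : M.eRank = r) {X : Finset α} (hX : X ∈ nonbases r M) :
    M.IsCircuit X := by
  obtain ⟨hX, hXB⟩ := mem_nonbases.1 hX
  have hdep : ¬ M.Indep X := fun hI => hXB <| hI.isBase_of_eRk_ge X.finite_toSet <| by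
    rw [hI.eRk_eq_encard, Set.encard_coe_eq_coe_finsetCard, hX, hr]
  obtain ⟨C, hCX, hC⟩ := ((Matroid.not_indep_iff (by simp [hE])).1 hdep).exists_isCircuit_subset
  have := hM C hC
  have hCX' : C = X := (X.finite_toSet.subset hCX).eq_of_subset_of_encard_le hCX (by
    rwa [Set.encard_coe_eq_coe_finsetCard, hX, ← hr])
  exact hCX' ▸ hC

theorem eq_of_nonbases_eq {r : ℕ} {M N : Matroid α} (hME : M.E = Set.univ)
    (hNE : N.E = Set.univ) (hM : M.eRank = r) (hN : N.eRank = r)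
    (h : nonbases r M = nonbases r N) : M = N := by
  refine Matroid.ext_isBase (hME.trans hNE.symm) fun B _ => ?_
  obtain ⟨X, rfl⟩ := B.toFinite.exists_finset_coe
  have key : ∀ L : Matroid α, L.eRank = r → (L.IsBase X ↔ X.card = r ∧ X ∉ nonbases r L) := by
    intro L hL
    rw [mem_nonbases]
    refine ⟨fun hB => ⟨?_, fun h => h.2 hB⟩, fun ⟨h1, h2⟩ => by_contra fun hB => h2 ⟨h1, hB⟩⟩
    have := hB.encard_eq_eRank
    rw [Set.encard_coe_eq_coe_finsetCard, hL] at this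
    exact_mod_cast this
  rw [key M hM, key N hN, h]

variable [DecidableEq α]

theorem isCocircuit_compl_of_mem_nonbases {r : ℕ} {M : Matroid α} (hE : M.E = Set.univ)
    (hM : IsPaving M.dual) (hr : M.eRank = r) {X : Finset α} (hX : X ∈ nonbases r M) :
    M.IsCocircuit (Xᶜ : Finset α) := by
  obtain ⟨hX, hXB⟩ := mem_nonbases.1 hX
  have hsum := M.eRank_add_eRank_dual
  rw [hr, hE, Set.encard_univ, ENat.card_eq_coe_fintype_card] at hsum
  have hXle : X.card ≤ Fintype.card α := Finset.card_le_univ X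
  refine isCircuit_of_mem_nonbases (r := Fintype.card α - r) (M := M.dual) (by simpa using hE)
    hM ?_ (mem_nonbases.2 ⟨by rw [Finset.card_compl, hX], fun hB => hXB ?_⟩)
  · have hr' : M✶.eRank ≠ ⊤ := fun h => by rw [h] at hsum; simp at hsum
    change M✶.eRank = _
    lift M✶.eRank to ℕ using hr' with d
    norm_cast at hsum ⊢
    omega
  · have hd := hB.compl_isBase_dual
    change M✶✶.IsBase (M✶.E \ _) at hd
    rw [Matroid.dual_dual, Matroid.dual_ground, hE, ← Set.compl_eq_univ_sdiff,
      ← Finset.coe_compl, compl_compl] at hd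
    exact hd

/-- Orthogonality: for adjacent nonbases `X, Y`, the circuit `Y` and the cocircuit `Xᶜ` would meet
in exactly one element. -/
theorem isStableFamily_nonbases {r : ℕ} {M : Matroid α} (hE : M.E = Set.univ)
    (hM : IsSparsePaving M) (hr : M.eRank = r) : IsStableFamily r (nonbases r M) := by
  refine ⟨fun X hX => (mem_nonbases.1 hX).1, fun X hX Y hY hne => ?_⟩
  by_contra hcon
  have hC := isCircuit_of_mem_nonbases hE hM.1 hr hY
  have hK := isCocircuit_compl_of_mem_nonbases hE hM.2 hr hX
  have hXc := (mem_nonbases.1 hX).1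
  have hYc := (mem_nonbases.1 hY).1
  have hle : (Y \ X).card ≤ 1 := by
    have := Finset.card_sdiff_add_card_inter Y X
    rw [Finset.inter_comm] at this
    omega
  have hpos : 0 < (Y \ X).card := by
    rw [Finset.card_pos, Finset.sdiff_nonempty]
    exact fun hYX => hne (Finset.eq_of_subset_of_card_le hYX (by omega)).symm
  obtain ⟨e, he⟩ := Finset.card_eq_one.1 (show (Y \ X).card = 1 by omega)
  refine hC.inter_isCocircuit_ne_singleton hK (e := e) ?_
  rw [← Finset.coe_inter, ← Finset.coe_singleton, ← he, Finset.sdiff_eq_inter_compl]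

/-- A nonbasis containing just one of `a, b` would differ from its image, also a nonbasis, by a
single exchange. -/
theorem nonbases_mem_iff_of_isAutomorphism_swap {r : ℕ} {M : Matroid α} (hE : M.E = Set.univ)
    (hM : IsSparsePaving M) (hr : M.eRank = r) {a b : α}
    (haut : IsAutomorphism M (Equiv.swap a b)) {Z : Finset α} (hZ : Z ∈ nonbases r M) :
    a ∈ Z ↔ b ∈ Z := by
  have key : ∀ c d : α, IsAutomorphism M (Equiv.swap c d) → c ∈ Z → d ∈ Z := by
    intro c d haut hc
    by_contra hd
    obtain ⟨hZc, hZB⟩ := mem_nonbases.1 hZ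
    have hW : Z.image (Equiv.swap c d) ∈ nonbases r M := by
      refine mem_nonbases.2 ⟨?_, ?_⟩
      · rw [Finset.card_image_of_injective _ (Equiv.injective _), hZc]
      · rwa [Finset.coe_image, ← haut]
    have heq := (isStableFamily_nonbases hE hM hr).eq_of_mem hZ hW (by
      have : Z.erase c ⊆ Z ∩ Z.image (Equiv.swap c d) := fun x hx => by
        obtain ⟨hxc, hx⟩ := Finset.mem_erase.1 hx
        refine Finset.mem_inter.2 ⟨hx, Finset.mem_image.2 ⟨x, hx, ?_⟩⟩
        exact Equiv.swap_apply_of_ne_of_ne hxc (fun h => hd (h ▸ hx))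
      have := Finset.card_le_card this
      rw [Finset.card_erase_of_mem hc] at this
      omega)
    apply hd
    rw [heq]
    exact Finset.mem_image.2 ⟨c, hc, Equiv.swap_apply_left c d⟩
  exact ⟨key a b haut, key b a (Equiv.swap_comm a b ▸ haut)⟩

end Nonbases

/-! ### Comparing the two counts -/

theorem sum_card_stableFamilies_le (n : ℕ) :
    ∑ r ∈ Finset.Ioo 0 n, (stableFamilies n r).card ≤ (sparsePavingMatroids n).ncard := by
  classical
  have := finite_matroid (Fin n)
  rw [← Finset.card_sigma, ← Set.ncard_coe_finset]
  have hmem : ∀ p ∈ (Finset.Ioo 0 n).sigma (stableFamilies n),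
      IsStableFamily p.1 p.2 ∧ 0 < p.1 ∧ p.1 < Fintype.card (Fin n) := by
    intro p hp
    rw [Finset.mem_sigma, Finset.mem_Ioo, mem_stableFamilies] at hp
    simpa using ⟨hp.2, hp.1⟩
  -- The value `Matroid.emptyOn` is a default never taken on the domain of the sum.
  refine Set.ncard_le_ncard_of_injOn (fun p => if h : IsStableFamily p.1 p.2 ∧ 0 < p.1 ∧
    p.1 < Fintype.card (Fin n) then matroidOfStable h.1 h.2.1 h.2.2 else Matroid.emptyOn _) ?_ ?_
    (Set.toFinite _)
  · intro p hp
    rw [Finset.mem_coe] at hp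
    simp only [dif_pos (hmem p hp)]
    exact ⟨rfl, matroidOfStable_isSparsePaving _ _ _⟩
  · rintro ⟨r, S⟩ hp ⟨r', S'⟩ hp' heq
    rw [Finset.mem_coe] at hp hp'
    obtain ⟨h, hr, hrn⟩ := hmem _ hp
    obtain ⟨h', hr', hrn'⟩ := hmem _ hp'
    simp only [dif_pos (hmem _ hp), dif_pos (hmem _ hp')] at heq h hr hrn h' hr' hrn'
    have hiff : ∀ X : Finset (Fin n), (X.card = r ∧ X ∉ S) ↔ (X.card = r' ∧ X ∉ S') := by
      intro X
      rw [← matroidOfStable_isBase_coe h hr hrn, heq, matroidOfStable_isBase_coe h' hr' hrn']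
    obtain ⟨B, -, hB⟩ := h.exists_superset_notMem hrn (Z := ∅) (by simpa using hr)
    obtain rfl : r = r' := hB.1.symm.trans ((hiff B).1 hB).1
    have : S = S' := by
      ext X
      have h1 := hiff X
      have h2 := h.1 X
      have h3 := h'.1 X
      tauto
    rw [this]

/-- Rank and nonbases determine the matroid. Ordered pairs count each transposition twice, which is
harmless for an upper bound. -/
theorem ncard_withAut_transpositions_le (n : ℕ) :
    (sparsePavingMatroidsWithAut n (transpositions n)).ncard ≤
      ∑ r ∈ Finset.range (n + 1), ∑ p ∈ (Finset.univ : Finset (Fin n)).offDiag,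
        (stableFamiliesWithPair r p.1 p.2).card := by
  classical
  have := finite_matroid (Fin n)
  simp_rw [← Finset.sum_product', ← Finset.card_sigma, ← Set.ncard_coe_finset]
  have hex : ∀ M ∈ sparsePavingMatroidsWithAut n (transpositions n),
      ∃ q : (_ : ℕ × Fin n × Fin n) × Finset (Finset (Fin n)),
        q ∈ (Finset.range (n + 1) ×ˢ (Finset.univ : Finset (Fin n)).offDiag).sigma
          (fun q => stableFamiliesWithPair q.1 q.2.1 q.2.2) ∧
        M.eRank = q.1.1 ∧ q.2 = nonbases q.1.1 M := by
    rintro M ⟨⟨hE, hM⟩, π, hπ, haut⟩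
    obtain ⟨a, b, hab, rfl⟩ := Equiv.Perm.card_support_eq_two.1 hπ
    obtain ⟨B, hB⟩ := M.exists_isBase
    obtain ⟨X, rfl⟩ := B.toFinite.exists_finset_coe
    have hr : M.eRank = X.card := by
      rw [← hB.encard_eq_eRank, Set.encard_coe_eq_coe_finsetCard]
    refine ⟨⟨(X.card, a, b), nonbases X.card M⟩, ?_, hr, rfl⟩
    simp only [Finset.mem_sigma, Finset.mem_product, Finset.mem_range, Finset.mem_offDiag,
      Finset.mem_univ, true_and, mem_stableFamiliesWithPair]
    have := Finset.card_le_univ X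
    rw [Fintype.card_fin] at this
    exact ⟨⟨by omega, hab⟩, isStableFamily_nonbases hE hM hr, fun Z hZ =>
      nonbases_mem_iff_of_isAutomorphism_swap hE hM hr haut hZ⟩
  rcases (sparsePavingMatroidsWithAut n (transpositions n)).eq_empty_or_nonempty with h | ⟨M, hM⟩
  · simp [h]
  have : Nonempty ((_ : ℕ × Fin n × Fin n) × Finset (Finset (Fin n))) := ⟨(hex M hM).choose⟩
  choose! f hf using hex
  refine Set.ncard_le_ncard_of_injOn f (fun M hM => (hf M hM).1) ?_ (Set.toFinite _)
  intro M hM N hN heq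
  obtain ⟨-, hM1, hM2⟩ := hf M hM
  obtain ⟨-, hN1, hN2⟩ := hf N hN
  rw [← heq] at hN1 hN2
  exact eq_of_nonbases_eq hM.1.1 hN.1.1 hM1 hN1 (hM2.symm.trans hN2)

/-- The switching bound applies when `C(n-2, r-1) > n^5`, and otherwise `C(n, r) ≤ n^6` makes the
trivial count suffice. Of the factor `n^3`, two powers pay for the choice of pair and one is the
final gain. -/
theorem pow_three_mul_card_stableFamiliesWithPair_le {n r : ℕ} (hrn : r ≤ n)
    {a b : Fin n} (hab : a ≠ b) :
    n ^ 3 * (stableFamiliesWithPair r a b).card ≤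
      4 * (if r ∈ Finset.Ioo 0 n then (stableFamilies n r).card else 0) +
        n ^ 3 * 2 ^ n ^ 6 := by
  have hn : 1 ≤ n := by have := a.2; omega
  have hcrude : n.choose r ≤ n ^ 6 → (stableFamiliesWithPair r a b).card ≤ 2 ^ n ^ 6 := fun h =>
    (Finset.card_le_card (Finset.filter_subset _ _)).trans
      ((card_stableFamilies_le n r).trans (Nat.pow_le_pow_right (by norm_num) h))
  by_cases hr : r ∈ Finset.Ioo 0 n
  · rw [if_pos hr]
    rw [Finset.mem_Ioo] at hr
    by_cases hm : (n - 2).choose (r - 1) ≤ n ^ 5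
    · have := hcrude ((choose_le_mul_choose_sub_two hr.1 hr.2).trans
        ((Nat.mul_le_mul_left n hm).trans_eq (by ring)))
      exact (Nat.mul_le_mul_left _ this).trans (Nat.le_add_left _ _)
    · refine le_trans ?_ (Nat.le_add_right _ _)
      refine le_of_mul_le_mul_left (a := n ^ 2) ?_ (by positivity)
      have h1 := card_stableFamiliesWithPair_mul_choose_le hab hr.1
      have h2 : (n + 1) ^ 2 ≤ 4 * n ^ 2 := by nlinarith
      calc n ^ 2 * (n ^ 3 * (stableFamiliesWithPair r a b).card)
          = (stableFamiliesWithPair r a b).card * n ^ 5 := by ring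
        _ ≤ (stableFamiliesWithPair r a b).card * (n - 2).choose (r - 1) :=
            Nat.mul_le_mul_left _ (by omega)
        _ ≤ (n + 1) ^ 2 * (stableFamilies n r).card := h1
        _ ≤ 4 * n ^ 2 * (stableFamilies n r).card := Nat.mul_le_mul_right _ h2
        _ = _ := by ring
  -- In the extreme ranks `C(n, r) = 1`, so the trivial count suffices.
  · have hr' : r = 0 ∨ r = n := by rw [Finset.mem_Ioo] at hr; omega
    have : n.choose r ≤ n ^ 6 := by
      rcases hr' with rfl | rfl <;> simpa using Nat.one_le_pow _ _ hn
    exact (Nat.mul_le_mul_left _ (hcrude this)).trans (Nat.le_add_left _ _)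

theorem mul_ncard_withAut_transpositions_le {n : ℕ} (hn : 1 ≤ n) :
    n * (sparsePavingMatroidsWithAut n (transpositions n)).ncard ≤
      4 * (sparsePavingMatroids n).ncard + (n + 1) * (n ^ 3 * 2 ^ n ^ 6) := by
  have hpair : ∀ r ∈ Finset.range (n + 1),
      n * ∑ p ∈ (Finset.univ : Finset (Fin n)).offDiag,
        (stableFamiliesWithPair r p.1 p.2).card ≤
      4 * (if r ∈ Finset.Ioo 0 n then (stableFamilies n r).card else 0) +
        n ^ 3 * 2 ^ n ^ 6 := by
    intro r hr
    rw [Finset.mem_range] at hr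
    refine le_of_mul_le_mul_left (a := n ^ 2) ?_ (by positivity)
    calc n ^ 2 * (n * ∑ p ∈ (Finset.univ : Finset (Fin n)).offDiag,
          (stableFamiliesWithPair r p.1 p.2).card)
        = ∑ p ∈ (Finset.univ : Finset (Fin n)).offDiag,
          n ^ 3 * (stableFamiliesWithPair r p.1 p.2).card := by rw [← Finset.mul_sum]; ring
      _ ≤ (Finset.univ : Finset (Fin n)).offDiag.card • _ :=
          Finset.sum_le_card_nsmul _ _ _ fun p hp =>
            pow_three_mul_card_stableFamiliesWithPair_le (by omega) (Finset.mem_offDiag.1 hp).2.2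
      _ ≤ _ := by
          rw [smul_eq_mul, Finset.offDiag_card, Finset.card_univ, Fintype.card_fin, sq]
          exact Nat.mul_le_mul_right _ (Nat.sub_le _ _)
  calc n * (sparsePavingMatroidsWithAut n (transpositions n)).ncard
      ≤ n * ∑ r ∈ Finset.range (n + 1), ∑ p ∈ (Finset.univ : Finset (Fin n)).offDiag,
        (stableFamiliesWithPair r p.1 p.2).card :=
        Nat.mul_le_mul_left _ (ncard_withAut_transpositions_le n)
    _ ≤ ∑ r ∈ Finset.range (n + 1),
        (4 * (if r ∈ Finset.Ioo 0 n then (stableFamilies n r).card else 0) +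
          n ^ 3 * 2 ^ n ^ 6) := by
        rw [Finset.mul_sum]
        exact Finset.sum_le_sum hpair
    _ = 4 * ∑ r ∈ Finset.Ioo 0 n, (stableFamilies n r).card +
        (n + 1) * (n ^ 3 * 2 ^ n ^ 6) := by
        have hinter : Finset.range (n + 1) ∩ Finset.Ioo 0 n = Finset.Ioo 0 n :=
          Finset.inter_eq_right.2 fun r hr => by
            simp only [Finset.mem_Ioo, Finset.mem_range] at hr ⊢; omega
        rw [Finset.sum_add_distrib, ← Finset.mul_sum, Finset.sum_ite_mem, hinter]
        simp
    _ ≤ _ := by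
        have := sum_card_stableFamilies_le n
        omega

/-! ### Asymptotics -/

theorem two_pow_le_ncard_sparsePavingMatroids {n k : ℕ} (hn : 2 ≤ n)
    (h : n * (n + 1) * k ≤ 2 ^ n) : 2 ^ k ≤ (sparsePavingMatroids n).ncard :=
  (two_pow_le_card_stableFamilies (by omega) h).trans <|
    (Finset.single_le_sum (f := fun r => (stableFamilies n r).card) (fun _ _ => Nat.zero_le _)
      (Finset.mem_Ioo.2 ⟨by omega, by omega⟩)).trans (sum_card_stableFamilies_le n)

theorem eventually_pow_le_two_pow : ∀ᶠ n : ℕ in atTop, n * (n + 1) * n ^ 7 ≤ 2 ^ n := by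
  have h := (tendsto_pow_const_div_const_pow_of_one_lt 9 (one_lt_two (α := ℝ))).eventually
    (ge_mem_nhds (show (0 : ℝ) < 1 / 2 by norm_num))
  filter_upwards [h, eventually_ge_atTop 1] with n hn h1
  rw [div_le_iff₀ (by positivity)] at hn
  have h2 : 2 * n ^ 9 ≤ 2 ^ n := by
    have : (2 * n ^ 9 : ℝ) ≤ 2 ^ n := by linarith
    exact_mod_cast this
  calc n * (n + 1) * n ^ 7 ≤ n * (n + n) * n ^ 7 := by gcongr
    _ = 2 * n ^ 9 := by ring
    _ ≤ _ := h2

/-- Absorbs the error from ranks with few `r`-sets into the lower bound `2^(n^7)` for the total. -/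
theorem mul_two_pow_le {n : ℕ} (hn : 2 ≤ n) : (n + 1) * (n ^ 3 * 2 ^ n ^ 6) ≤ 2 ^ n ^ 7 := by
  have h1 : n + 1 ≤ 2 ^ n := Nat.lt_two_pow_self
  have h2 : n ^ 3 ≤ (2 ^ n) ^ 3 := Nat.pow_le_pow_left (by omega) 3
  calc (n + 1) * (n ^ 3 * 2 ^ n ^ 6) ≤ 2 ^ n * ((2 ^ n) ^ 3 * 2 ^ n ^ 6) := by gcongr
    _ = 2 ^ (4 * n + n ^ 6) := by rw [← pow_mul, ← pow_add, ← pow_add]; congr 1; ring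
    _ ≤ 2 ^ n ^ 7 := by
        refine Nat.pow_le_pow_right (by norm_num) ?_
        have h5 : 2 ^ 5 ≤ n ^ 5 := Nat.pow_le_pow_left hn 5
        calc 4 * n + n ^ 6 ≤ n ^ 5 * n + n ^ 6 := by gcongr; omega
          _ = 2 * n ^ 6 := by ring
          _ ≤ n * n ^ 6 := by gcongr
          _ = n ^ 7 := by ring

end SparsePaving

theorem mainTheorem4 :
    Tendsto
      (fun n : ℕ =>
        ((SparsePaving.sparsePavingMatroidsWithAut n (SparsePaving.transpositions n)).ncard : ℝ) /
          ((SparsePaving.sparsePavingMatroids n).ncard : ℝ))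
      atTop (𝓝 0) := by
  refine tendsto_of_tendsto_of_tendsto_of_le_of_le' tendsto_const_nhds
    (tendsto_const_div_atTop_nhds_zero_nat (5 : ℝ)) (Eventually.of_forall fun n => by positivity) ?_
  filter_upwards [SparsePaving.eventually_pow_le_two_pow, eventually_ge_atTop 2] with n hpow hn
  have h1 := SparsePaving.mul_ncard_withAut_transpositions_le (n := n) (by omega)
  have h2 := (SparsePaving.mul_two_pow_le hn).trans
    (SparsePaving.two_pow_le_ncard_sparsePavingMatroids hn hpow)
  have hpos := SparsePaving.sparsePavingMatroids_ncard_pos n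
  rw [div_le_div_iff₀ (by exact_mod_cast hpos) (by positivity)]
  -- The constant 5 is 4 from the switching bound plus 1 for the absorbed error.
  have h3 : (SparsePaving.sparsePavingMatroidsWithAut n (SparsePaving.transpositions n)).ncard * n ≤
      5 * (SparsePaving.sparsePavingMatroids n).ncard := by
    rw [mul_comm]; omega
  exact_mod_cast h3
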